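/- Let $X$ be a proper metric space with a conical geodesic bicombing $\sigma$, that is, a map $\sigma : X\times X\times[0,1]\to X$ such that, for all $x,y\in X$, the map $t\mapsto\sigma(x,y,t)$ is a constant speed geodesic from $x$ to $y$, and $$d(\sigma(x,y,t),\sigma(x',y',t))\le(1-t)\,d(x,x')+t\,d(y,y')\qquad\text{for all }x,x',y,y'\in X,\ t\in[0,1].$$ A $\sigma$-ray is a geodesic ray $c:[0,\infty)\to X$ (i.e. $d(c(s),c(t))=|s-t|$ for all $s,t\ge 0$) such that $\sigma(c(0),c(t),s)=c(st)$ for all $t\ge0$ and $s\in[0,1]$. Assume that $\sigma$ is geodesically complete: for all $x\ne y$ in $X$ there is a $\sigma$-ray $c$ with $c(0)=x$ and $c(d(x,y))=y$. Let $\partial X$ be the horoboundary of $X$, that is, the set of points of the closure of the image of $X\to\mathbb{R}^X/\mathbb{R}$, $x\mapsto d(x,\cdot)+\mathbb{R}$, that do not lie in this image (here $\mathbb{R}^X$ carries the product topology and $\mathbb{R}$ is the subgroup of constant functions). A point $\xi\in\partial X$ is a Busemann point if there is a geodesic ray $c$ such that $\lim_{t\to\infty}\big(d(x,c(t))-d(y,c(t))\big)=\xi(x)-\xi(y)$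 for all $x,y\in X$; it is then said to correspond to $c$. Let $x_0\in X$ and $N\in\mathbb{N}$ be such that at most $N$ Busemann points correspond to $\sigma$-rays $c$ from $c(0)=x_0$. Then the combinatorial dimension of $X$, i.e. the topological (Lebesgue covering) dimension of its injective hull $EX$, is at most $N$. Here $EX$ is the set of pointwise minimal functions among the $f:X\to\mathbb{R}$ such that $f(x)+f(y)\ge d(x,y)$ for all $x,y\in X$, with the metric $d(f,g)=\sup_{x\in X}|f(x)-g(x)|$. -/

import Mathlib

open Set Filter Topology

namespace CombDim

/-! ### Geodesic bicombings -/

/-- `σ x y : [0,1] → X` is, for all `x y`, a constant speed geodesic from `x` to `y`.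
The parameter is a real number, and only its values in `[0,1]` matter. -/
structure IsGeodesicBicombing {X : Type*} [MetricSpace X] (σ : X → X → ℝ → X) : Prop where
  map_zero : ∀ x y, σ x y 0 = x
  map_one : ∀ x y, σ x y 1 = y
  dist_eq : ∀ x y, ∀ s ∈ Icc (0 : ℝ) 1, ∀ t ∈ Icc (0 : ℝ) 1,
    dist (σ x y s) (σ x y t) = |s - t| * dist x y

/-- The conical inequality. -/
def IsConical {X : Type*} [MetricSpace X] (σ : X → X → ℝ → X) : Prop :=
  ∀ x x' y y' : X, ∀ t ∈ Icc (0 : ℝ) 1,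
    dist (σ x y t) (σ x' y' t) ≤ (1 - t) * dist x x' + t * dist y y'

/-- A (unit speed) geodesic ray `[0,∞) → X`; only the values of `c` on `[0,∞)` matter. -/
def IsGeodesicRay {X : Type*} [MetricSpace X] (c : ℝ → X) : Prop :=
  ∀ s t : ℝ, 0 ≤ s → 0 ≤ t → dist (c s) (c t) = |s - t|

/-- A `σ`-ray: a geodesic ray `c` such that, for every `t ≥ 0`, the initial segment `c|[0,t]` is
the geodesic from `c 0` to `c t` selected by `σ`. -/
structure IsCombingRay {X : Type*} [MetricSpace X] (σ : X → X → ℝ → X) (c : ℝ → X) : Prop where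
  isGeodesicRay : IsGeodesicRay c
  combing_eq : ∀ t : ℝ, 0 ≤ t → ∀ s ∈ Icc (0 : ℝ) 1, σ (c 0) (c t) s = c (s * t)

/-- `σ` is geodesically complete: every nondegenerate `σ`-geodesic, from `x` to `y`, is an initial
segment of a `σ`-ray. (That the ray prolongs `t ↦ σ x y t` is part of being a `σ`-ray from `x`
that passes through `y`.) -/
def IsGeodesicallyComplete {X : Type*} [MetricSpace X] (σ : X → X → ℝ → X) : Prop :=
  ∀ x y : X, x ≠ y → ∃ c : ℝ → X, IsCombingRay σ c ∧ c 0 = x ∧ c (dist x y) = y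

/-! ### The horoboundary and Busemann points -/

/-- The subgroup of constant functions in `ℝ^X`. -/
def constFun (X : Type*) : AddSubgroup (X → ℝ) := (Pi.constAddMonoidHom X ℝ).range

/-- The space `ℝ^X / ℝ`, with the quotient of the product topology. -/
abbrev FunModConst (X : Type*) : Type _ := (X → ℝ) ⧸ constFun X

/-- The well-defined difference `ξ(x) - ξ(y)`, for `ξ ∈ ℝ^X / ℝ`. -/
def FunModConst.diff {X : Type*} (ξ : FunModConst X) (x y : X) : ℝ :=
  QuotientAddGroup.lift (constFun X)
    (Pi.evalAddMonoidHom (fun _ : X => ℝ) x - Pi.evalAddMonoidHom (fun _ : X => ℝ) y)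
    (by rintro f ⟨a, rfl⟩; simp) ξ

theorem FunModConst.diff_mk {X : Type*} (f : X → ℝ) (x y : X) :
    FunModConst.diff (QuotientAddGroup.mk f : FunModConst X) x y = f x - f y := rfl

/-- The embedding `x ↦ d(x, ·) + ℝ` of `X` in `ℝ^X / ℝ`. -/
def horoEmbedding (X : Type*) [MetricSpace X] (x : X) : FunModConst X :=
  QuotientAddGroup.mk (fun y => dist x y)

/-- The horoboundary of `X`: the points in the closure of the image of `X` in `ℝ^X / ℝ` that do
not lie in this image. -/
def horoboundary (X : Type*) [MetricSpace X] : Set (FunModConst X) :=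
  closure (range (horoEmbedding X)) \ range (horoEmbedding X)

/-- `ξ` is the limit of the distance functions along `c`:
`d(x, c(t)) - d(y, c(t)) → ξ(x) - ξ(y)` as `t → ∞`, for all `x` and `y`. -/
def IsLimitOfRay {X : Type*} [MetricSpace X] (ξ : FunModConst X) (c : ℝ → X) : Prop :=
  ∀ x y : X, Tendsto (fun t : ℝ => dist x (c t) - dist y (c t)) atTop (𝓝 (ξ.diff x y))

/-- `ξ` is a Busemann point: a point of the horoboundary that is the limit of a geodesic ray. -/
def IsBusemannPoint {X : Type*} [MetricSpace X] (ξ : FunModConst X) : Prop :=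
  ξ ∈ horoboundary X ∧ ∃ c : ℝ → X, IsGeodesicRay c ∧ IsLimitOfRay ξ c

/-- The Busemann points that correspond to `σ`-rays from `x₀`. -/
def combingBusemannPoints {X : Type*} [MetricSpace X] (σ : X → X → ℝ → X) (x₀ : X) :
    Set (FunModConst X) :=
  {ξ | IsBusemannPoint ξ ∧ ∃ c : ℝ → X, IsCombingRay σ c ∧ c 0 = x₀ ∧ IsLimitOfRay ξ c}

/-! ### The injective hull -/

/-- `f(x) + f(y) ≥ d(x, y)` for all `x` and `y`. -/
def DominatesDist {X : Type*} [MetricSpace X] (f : X → ℝ) : Prop :=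
  ∀ x y, dist x y ≤ f x + f y

/-- The injective hull `EX` of `X` (Isbell): the set of extremal functions on `X`, i.e. the
pointwise minimal functions `f` such that `f(x) + f(y) ≥ d(x, y)` for all `x` and `y`. Below it
gets the supremum metric. -/
def InjectiveHull (X : Type*) [MetricSpace X] : Type _ :=
  {f : X → ℝ // Minimal DominatesDist f}

namespace InjectiveHull

variable {X : Type*} [MetricSpace X]

theorem le_dist_add (f : InjectiveHull X) (x y : X) : f.1 x ≤ dist x y + f.1 y := by
  have hf := f.2.1
  have h : DominatesDist (fun z => min (f.1 z) (dist z y + f.1 y)) := by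
    intro z w
    have h0 := hf y y
    have h1 := hf z w
    have h2 := hf z y
    have h3 := hf w y
    have h4 := dist_triangle_right z w y
    simp only [dist_self] at h0
    rcases min_choice (f.1 z) (dist z y + f.1 y) with h5 | h5 <;>
      rcases min_choice (f.1 w) (dist w y + f.1 y) with h6 | h6 <;>
      simp only [h5, h6] <;> linarith [@dist_nonneg _ _ z y, @dist_nonneg _ _ w y]
  exact (f.2.2 h (fun z => min_le_left _ _) x).trans (min_le_right _ _)

theorem bddAbove_abs_sub (f g : InjectiveHull X) :
    BddAbove (range fun x => |f.1 x - g.1 x|) := by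
  rcases isEmpty_or_nonempty X with hX | ⟨⟨y⟩⟩
  · simp [range_eq_empty]
  · refine ⟨f.1 y + g.1 y, ?_⟩
    rintro _ ⟨x, rfl⟩
    have h1 := f.le_dist_add x y
    have h2 := g.le_dist_add x y
    have h3 := f.2.1 x y
    have h4 := g.2.1 x y
    exact abs_le.2 ⟨by linarith, by linarith⟩

/-- The supremum metric `d(f, g) = sup |f - g|`. -/
noncomputable instance : MetricSpace (InjectiveHull X) where
  dist f g := ⨆ x, |f.1 x - g.1 x|
  dist_self f := by simp
  dist_comm f g := by simp only [abs_sub_comm]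
  dist_triangle f g h := by
    have h0 : ∀ a b : InjectiveHull X, 0 ≤ ⨆ x, |a.1 x - b.1 x| :=
      fun a b => Real.iSup_nonneg fun x => abs_nonneg _
    refine Real.iSup_le (fun x => ?_) (add_nonneg (h0 f g) (h0 g h))
    exact (abs_sub_le _ (g.1 x) _).trans
      (add_le_add (le_ciSup (bddAbove_abs_sub f g) x) (le_ciSup (bddAbove_abs_sub g h) x))
  eq_of_dist_eq_zero := by
    intro f g hfg
    refine Subtype.ext (funext fun x => ?_)
    have h1 : |f.1 x - g.1 x| ≤ ⨆ x, |f.1 x - g.1 x| := le_ciSup (bddAbove_abs_sub f g) x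
    have h2 : |f.1 x - g.1 x| ≤ 0 := h1.trans (le_of_eq hfg)
    exact sub_eq_zero.1 (abs_nonpos_iff.1 h2)

end InjectiveHull

/-! ### Topological dimension -/

/-- `T` has (Lebesgue) covering dimension at most `n`: every open cover of `T` has an open
refinement such that every point of `T` lies in at most `n + 1` of its members. -/
def CoveringDimLE (T : Type*) [TopologicalSpace T] (n : ℕ) : Prop :=
  ∀ U : Set (Set T), (∀ u ∈ U, IsOpen u) → ⋃₀ U = univ →
    ∃ V : Set (Set T), (∀ v ∈ V, IsOpen v) ∧ ⋃₀ V = univ ∧ (∀ v ∈ V, ∃ u ∈ U, v ⊆ u) ∧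
      ∀ p : T, {v | v ∈ V ∧ p ∈ v}.encard ≤ n + 1

open Classical in
/-- The topological (Lebesgue covering) dimension of `T`. It is `⊤` if no natural number bounds
it, and `⊥` for the empty space. -/
noncomputable def coveringDim (T : Type*) [TopologicalSpace T] : WithBot ℕ∞ :=
  if IsEmpty T then ⊥ else ((⨅ (n : ℕ) (_ : CoveringDimLE T n), (n : ℕ∞) : ℕ∞) : WithBot ℕ∞)

/-- The combinatorial dimension of `X`: the topological dimension of its injective hull. -/
noncomputable def combinatorialDim (X : Type*) [MetricSpace X] : WithBot ℕ∞ :=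
  coveringDim (InjectiveHull X)

end CombDim

open CombDim

/-! Each Busemann function is 1-Lipschitz and descends at unit speed along a ray defining it.
Geodesic completeness thus lets the finitely many Busemann points from `x₀` compute all distances
from `x₀`. For other pairs, prolong the geodesic to a ray `c`: one Busemann point computes `d(x₀, c
t)` for arbitrarily large `t`, and convexity along `c` carries this back to the pair, with an error
that vanishes as `t → ∞` (`exists_combingBusemannPoint_diff_eq`). So `X` embeds isometrically in a
finite-dimensional sup-norm space, hence so does its hull (`isometry_hullCoord`), and a subspace of
`ℝ^n` has covering dimension at most `n` (`coveringDimLE_of_isInducing`). -/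

namespace CombDim

/-! ### Covering dimension of subspaces of `ℝ^ι` -/

section Covering

/-- The points of `ℝ^ι` all of whose coordinates lie in the coset `ℚ + j√2`, given by their
rational parts. -/
noncomputable def shiftedRat {ι : Type*} (j : ℕ) (q : ι → ℚ) : ι → ℝ := fun i => q i + j * √2

theorem eq_of_rat_add_mul_sqrt_two_eq {a b : ℚ} {j k : ℕ}
    (h : (a : ℝ) + j * √2 = b + k * √2) : j = k := by
  by_contra hjk
  have hjk' : ((j : ℚ) - k) ≠ 0 := sub_ne_zero.2 (by exact_mod_cast hjk)
  have hjk'' : ((j : ℝ) - k) ≠ 0 := by exact_mod_cast hjk'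
  refine irrational_sqrt_two ⟨(b - a) / (j - k), ?_⟩
  push_cast
  rw [div_eq_iff hjk'']
  linarith

/-- A sup-norm sphere lies in the hyperplanes of its faces, and a rational radius keeps these in the
coset of the centre. -/
theorem exists_rat_add_mul_sqrt_two_of_dist_eq {ι : Type*} [Fintype ι] {j : ℕ} {q : ι → ℚ}
    {r : ℚ} (hr : 0 < r) {x : ι → ℝ} (hx : dist x (shiftedRat j q) = r) :
    ∃ i, ∃ a : ℚ, x i = a + j * √2 := by
  have hr' : (0 : ℝ) < r := by exact_mod_cast hr
  obtain ⟨i, hi⟩ := ((dist_pi_eq_iff hr').1 hx).1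
  rw [Real.dist_eq] at hi
  rcases (abs_eq hr'.le).1 hi with h | h
  · exact ⟨i, r + q i, by simp only [shiftedRat] at h; push_cast; linarith⟩
  · exact ⟨i, -r + q i, by simp only [shiftedRat] at h; push_cast; linarith⟩

theorem exists_shiftedRat_ball_subset {ι : Type*} [Fintype ι] (j : ℕ) {x : ι → ℝ}
    {O : Set (ι → ℝ)} (hO : IsOpen O) (hx : x ∈ O) :
    ∃ (q : ι → ℚ) (r : ℚ), 0 < r ∧ dist x (shiftedRat j q) < r ∧
      Metric.ball (shiftedRat j q) (r : ℝ) ⊆ O := by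
  obtain ⟨ε, hε, hsub⟩ := Metric.isOpen_iff.1 hO x hx
  obtain ⟨r, hr0, hr⟩ := exists_rat_btwn (half_pos hε)
  have hq : ∀ i, ∃ a : ℚ, x i - j * √2 < a ∧ (a : ℝ) < x i - j * √2 + r :=
    fun i => exists_rat_btwn (by linarith)
  choose q hq1 hq2 using hq
  have hd : dist x (shiftedRat j q) < r := by
    refine (dist_pi_lt_iff hr0).2 fun i => ?_
    rw [Real.dist_eq, abs_lt]
    simp only [shiftedRat]
    constructor <;> linarith [hq1 i, hq2 i]
  refine ⟨q, r, by exact_mod_cast hr0, hd, fun y hy => hsub ?_⟩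
  rw [Metric.mem_ball] at hy ⊢
  linarith [dist_triangle_right y x (shiftedRat j q)]

/-- A space that embeds in `ℝ^ι` has covering dimension at most the cardinality of `ι`. -/
theorem coveringDimLE_of_isInducing {T ι : Type*} [TopologicalSpace T] [Fintype ι]
    {φ : T → ι → ℝ} (hφ : IsInducing φ) : CoveringDimLE T (Fintype.card ι) := by
  classical
  intro U hU hcov
  obtain ⟨enc, henc⟩ := Countable.exists_injective_nat ((ι → ℚ) × ℚ)
  let good : ℕ → Set ((ι → ℚ) × ℚ) := fun j =>
    {b | 0 < b.2 ∧ ∃ u ∈ U, φ ⁻¹' Metric.ball (shiftedRat j b.1) (b.2 : ℝ) ⊆ u}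
  let earlier : ℕ → ((ι → ℚ) × ℚ) → Set ((ι → ℚ) × ℚ) := fun j b =>
    {b' | b' ∈ good j ∧ enc b' < enc b}
  -- Removing the earlier closed balls makes family `j` disjoint; they are finitely many, so the
  -- sets stay open. Only points over spheres can be lost.
  let W : ℕ → ((ι → ℚ) × ℚ) → Set T := fun j b =>
    φ ⁻¹' (Metric.ball (shiftedRat j b.1) (b.2 : ℝ) \
      ⋃ b' ∈ earlier j b, Metric.closedBall (shiftedRat j b'.1) (b'.2 : ℝ))
  have hWopen : ∀ j b, IsOpen (W j b) := by
    intro j b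
    refine (Metric.isOpen_ball.sdiff ?_).preimage hφ.continuous
    refine Set.Finite.isClosed_biUnion ?_ fun b' _ => Metric.isClosed_closedBall
    exact ((finite_lt_nat (enc b)).preimage henc.injOn).subset fun b' hb' => hb'.2
  have hWdisj : ∀ j, ∀ b ∈ good j, ∀ b' ∈ good j, ∀ p, p ∈ W j b → p ∈ W j b' → b = b' := by
    have key : ∀ j, ∀ b ∈ good j, ∀ b', ∀ p, p ∈ W j b → p ∈ W j b' → ¬ enc b < enc b' := by
      intro j b hb b' p hp hp' hlt
      exact hp'.2 (mem_biUnion (show b ∈ earlier j b' from ⟨hb, hlt⟩)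
        (Metric.ball_subset_closedBall hp.1))
    intro j b hb b' hb' p hp hp'
    exact henc (le_antisymm (not_lt.1 (key j b' hb' b p hp' hp)) (not_lt.1 (key j b hb b' p hp hp')))
  have hWcov : ∀ j p, (∀ b ∈ good j, p ∉ W j b) → ∃ i, ∃ a : ℚ, φ p i = a + j * √2 := by
    intro j p hp
    obtain ⟨u, huU, hpu⟩ : p ∈ ⋃₀ U := hcov ▸ mem_univ p
    obtain ⟨O, hO, rfl⟩ := hφ.isOpen_iff.1 (hU u huU)
    obtain ⟨q, r, hr, hd, hsub⟩ := exists_shiftedRat_ball_subset j hO hpu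
    -- Take the first good closed ball containing `φ p`: a missed point must lie on its sphere.
    have hex : ∃ n, ∃ b ∈ good j, enc b = n ∧ dist (φ p) (shiftedRat j b.1) ≤ b.2 :=
      ⟨_, (q, r), ⟨hr, _, huU, preimage_mono hsub⟩, rfl, hd.le⟩
    obtain ⟨b, hb, hbn, hbd⟩ := Nat.find_spec hex
    rcases hbd.lt_or_eq with hlt | heq
    · refine absurd ⟨hlt, ?_⟩ (hp b hb)
      simp only [mem_iUnion, not_exists]
      intro b' hb' hmem
      exact Nat.find_min hex (hbn ▸ hb'.2) ⟨b', hb'.1, rfl, hmem⟩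
    · exact exists_rat_add_mul_sqrt_two_of_dist_eq hb.1 heq
  refine ⟨{v | ∃ j : Fin (Fintype.card ι + 1), ∃ b ∈ good j, v = W j b}, ?_, ?_, ?_, ?_⟩
  · rintro v ⟨j, b, -, rfl⟩
    exact hWopen j b
  · refine eq_univ_of_forall fun p => ?_
    by_contra hp
    have hmiss : ∀ j : Fin (Fintype.card ι + 1), ∃ i, ∃ a : ℚ, φ p i = a + (j : ℕ) * √2 :=
      fun j => hWcov j p fun b hb hpb => hp ⟨_, ⟨j, b, hb, rfl⟩, hpb⟩
    choose f a hfa using hmiss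
    -- There is one more family than coordinates, so a point missed by all has a coordinate in two
    -- disjoint cosets.
    obtain ⟨j, k, hjk, hf⟩ := Fintype.exists_ne_map_eq_of_card_lt f (by simp)
    exact hjk (Fin.ext (eq_of_rat_add_mul_sqrt_two_eq ((hfa j).symm.trans (hf ▸ hfa k))))
  · rintro v ⟨j, b, hb, rfl⟩
    obtain ⟨u, huU, hu⟩ := hb.2
    exact ⟨u, huU, (preimage_mono sdiff_subset).trans hu⟩
  · intro p
    choose! col hcol using fun (v : Set T) (hv : v ∈ {v | ∃ j : Fin (Fintype.card ι + 1),
      ∃ b ∈ good j, v = W j b}) => hv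
    have hinj : InjOn col {v | v ∈ {v | ∃ j : Fin (Fintype.card ι + 1),
        ∃ b ∈ good j, v = W j b} ∧ p ∈ v} := by
      rintro v ⟨hv, hpv⟩ w ⟨hw, hpw⟩ hvw
      obtain ⟨b, hb, hvb⟩ := hcol v hv
      obtain ⟨b', hb', hwb⟩ := hcol w hw
      rw [← hvw] at hb' hwb
      rw [hvb] at hpv
      rw [hwb] at hpw
      rw [hvb, hwb, hWdisj _ b hb b' hb' p hpv hpw]
    calc _ = (col '' _).encard := hinj.encard_image.symm
      _ ≤ (univ : Set (Fin (Fintype.card ι + 1))).encard := encard_le_encard (subset_univ _)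
      _ = _ := by simp

theorem coveringDim_le {T : Type*} [TopologicalSpace T] {n : ℕ} (h : CoveringDimLE T n) :
    coveringDim T ≤ n := by
  unfold coveringDim
  split_ifs
  · exact bot_le
  · exact WithBot.coe_le_coe.2 (iInf₂_le n h)

end Covering

/-! ### Injective hulls of subspaces of `ℝ^ι` -/

section Hull

variable {X ι : Type*} [MetricSpace X] [Fintype ι]

/-- The extension to the injective hull of the coordinates of a map `X → ℝ^ι`. -/
noncomputable def hullCoord (e : X → ι → ℝ) (f : InjectiveHull X) : ι → ℝ :=
  fun i => ⨅ x, (e x i + f.1 x)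

theorem sub_apply_le_add_apply {e : X → ι → ℝ} (he : Isometry e) (f : InjectiveHull X) (i : ι)
    (x y : X) : e y i - f.1 y ≤ e x i + f.1 x := by
  have h1 := f.2.1 y x
  have h2 := (dist_le_pi_dist (e y) (e x) i).trans_eq (he.dist_eq y x)
  rw [Real.dist_eq] at h2
  linarith [le_abs_self (e y i - e x i)]

theorem bddBelow_hullCoord {e : X → ι → ℝ} (he : Isometry e) (f : InjectiveHull X) (i : ι) :
    BddBelow (range fun x => e x i + f.1 x) := by
  rcases isEmpty_or_nonempty X with hX | ⟨⟨y⟩⟩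
  · simp [range_eq_empty]
  · exact ⟨e y i - f.1 y, forall_mem_range.2 fun x => sub_apply_le_add_apply he f i x y⟩

theorem InjectiveHull.apply_nonneg (f : InjectiveHull X) (x : X) : 0 ≤ f.1 x := by
  have h := f.2.1 x x
  rw [dist_self] at h
  linarith

/-- The distances to any point of `ℝ^ι` dominate the metric, so once they are at most `f`,
minimality of `f` forces equality. -/
theorem hullCoord_dist_eq [Nonempty X] {e : X → ι → ℝ} (he : Isometry e)
    (f : InjectiveHull X) (x : X) : dist (hullCoord e f) (e x) = f.1 x := by
  have hle : ∀ x, dist (hullCoord e f) (e x) ≤ f.1 x := by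
    intro x
    refine (dist_pi_le_iff (f.apply_nonneg x)).2 fun i => ?_
    have h1 : hullCoord e f i ≤ e x i + f.1 x := ciInf_le (bddBelow_hullCoord he f i) x
    have h2 : e x i - f.1 x ≤ hullCoord e f i := le_ciInf fun y => sub_apply_le_add_apply he f i y x
    rw [Real.dist_eq, abs_le]
    constructor <;> linarith
  have hdom : DominatesDist fun x => dist (hullCoord e f) (e x) := by
    intro x y
    rw [← he.dist_eq]
    exact dist_triangle_left _ _ _
  exact le_antisymm (hle x) (f.2.2 hdom hle x)

/-- If `X` embeds isometrically in `ℝ^ι` with the supremum norm, then so does its injective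
hull. -/
theorem isometry_hullCoord [Nonempty X] {e : X → ι → ℝ} (he : Isometry e) :
    Isometry (hullCoord e) := by
  refine Isometry.of_dist_eq fun f g => le_antisymm ?_ ?_
  · refine (dist_pi_le_iff dist_nonneg).2 fun i => ?_
    have key : ∀ f g : InjectiveHull X, hullCoord e f i ≤ hullCoord e g i + dist f g := by
      intro f g
      rw [← sub_le_iff_le_add]
      refine le_ciInf fun x => ?_
      have h1 : hullCoord e f i ≤ e x i + f.1 x := ciInf_le (bddBelow_hullCoord he f i) x
      have h2 : |f.1 x - g.1 x| ≤ dist f g := le_ciSup (InjectiveHull.bddAbove_abs_sub f g) x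
      linarith [le_abs_self (f.1 x - g.1 x)]
    have h1 := key f g
    have h2 := key g f
    rw [dist_comm] at h2
    rw [Real.dist_eq, abs_le]
    constructor <;> linarith
  · refine ciSup_le fun x => ?_
    rw [← hullCoord_dist_eq he f, ← hullCoord_dist_eq he g]
    exact abs_dist_sub_le _ _ _

theorem combinatorialDim_le_card [Nonempty X] {e : X → ι → ℝ} (he : Isometry e) :
    combinatorialDim X ≤ (Fintype.card ι : ℕ) :=
  coveringDim_le (coveringDimLE_of_isInducing (isometry_hullCoord he).isUniformInducing.isInducing)

end Hull

/-! ### Busemann points and distances -/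

section Rays

theorem FunModConst.diff_add_diff {X : Type*} (ξ : FunModConst X) (x y z : X) :
    ξ.diff x y + ξ.diff y z = ξ.diff x z := by
  induction ξ using QuotientAddGroup.induction_on with
  | H f => simp only [FunModConst.diff_mk]; ring

variable {X : Type*} [MetricSpace X]

theorem IsGeodesicRay.exists_tendsto {c : ℝ → X} (hc : IsGeodesicRay c) (x : X) :
    ∃ b, Tendsto (fun t => dist x (c t) - t) atTop (𝓝 b) := by
  -- The truncation is needed because `c` is arbitrary at negative times.
  have hanti : Antitone fun t => dist x (c (max t 0)) - max t 0 := by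
    intro s t hst
    have h1 := max_le_max_right 0 hst
    have h2 := hc (max s 0) (max t 0) (le_max_right _ _) (le_max_right _ _)
    rw [abs_sub_comm, abs_of_nonneg (sub_nonneg.2 h1)] at h2
    have h3 := dist_triangle x (c (max s 0)) (c (max t 0))
    show dist x (c (max t 0)) - max t 0 ≤ dist x (c (max s 0)) - max s 0
    linarith
  have hbdd : BddBelow (range fun t => dist x (c (max t 0)) - max t 0) := by
    refine ⟨-dist x (c 0), forall_mem_range.2 fun t => ?_⟩
    have h1 := hc 0 (max t 0) le_rfl (le_max_right _ _)
    rw [zero_sub, abs_neg, abs_of_nonneg (le_max_right _ _)] at h1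
    linarith [dist_triangle_left (c 0) (c (max t 0)) x]
  refine ⟨_, (tendsto_atTop_ciInf hanti hbdd).congr' ?_⟩
  filter_upwards [eventually_ge_atTop 0] with t ht
  rw [max_eq_left ht]

theorem IsLimitOfRay.diff_apply {c : ℝ → X} (hc : IsGeodesicRay c) {ξ : FunModConst X}
    (hξ : IsLimitOfRay ξ c) {s : ℝ} (hs : 0 ≤ s) : ξ.diff (c 0) (c s) = s := by
  refine tendsto_nhds_unique (hξ (c 0) (c s)) (tendsto_const_nhds.congr' ?_)
  filter_upwards [eventually_ge_atTop s] with t ht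
  rw [hc 0 t le_rfl (hs.trans ht), hc s t hs (hs.trans ht), abs_sub_comm 0, abs_sub_comm s,
    abs_of_nonneg (by linarith), abs_of_nonneg (by linarith)]
  ring

/-- Every geodesic ray converges to a Busemann point. -/
theorem IsGeodesicRay.exists_isLimitOfRay {c : ℝ → X} (hc : IsGeodesicRay c) :
    ∃ ξ : FunModConst X, IsBusemannPoint ξ ∧ IsLimitOfRay ξ c := by
  choose b hb using hc.exists_tendsto
  have hlim : IsLimitOfRay (QuotientAddGroup.mk b : FunModConst X) c := by
    intro x y
    rw [FunModConst.diff_mk]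
    refine ((hb x).sub (hb y)).congr fun t => ?_
    ring
  refine ⟨QuotientAddGroup.mk b, ⟨⟨?_, ?_⟩, c, hc, hlim⟩, hlim⟩
  · have h1 : Tendsto (fun t : ℝ => fun x => dist x (c t) - t) atTop (𝓝 b) :=
      tendsto_pi_nhds.2 hb
    have h2 : Tendsto (fun t : ℝ => horoEmbedding X (c t)) atTop
        (𝓝 (QuotientAddGroup.mk b : FunModConst X)) := by
      refine ((continuous_quot_mk.tendsto b).comp h1).congr fun t => ?_
      refine QuotientAddGroup.eq.2 ⟨t, funext fun x => ?_⟩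
      simp [dist_comm x (c t)]
    exact mem_closure_of_tendsto h2 (Eventually.of_forall fun t => mem_range_self _)
  · rintro ⟨z, hz⟩
    -- At this time, a limit equal to `d(z, ·)` would give `d(z, c t) = -1`.
    have h0 : (0 : ℝ) ≤ dist z (c 0) + 1 := by positivity
    have h1 := hlim.diff_apply hc h0
    rw [← hz, horoEmbedding, FunModConst.diff_mk] at h1
    linarith [dist_nonneg (x := z) (y := c (dist z (c 0) + 1))]

theorem IsLimitOfRay.abs_diff_le {c : ℝ → X} {ξ : FunModConst X} (hξ : IsLimitOfRay ξ c)
    (x y : X) : |ξ.diff x y| ≤ dist x y :=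
  le_of_tendsto (hξ x y).abs (Eventually.of_forall fun _ => abs_dist_sub_le _ _ _)

theorem IsGeodesicBicombing.apply_self {σ : X → X → ℝ → X} (hσ : IsGeodesicBicombing σ)
    (x : X) {t : ℝ} (ht : t ∈ Icc (0 : ℝ) 1) : σ x x t = x := by
  have h := hσ.dist_eq x x t ht 0 ⟨le_rfl, zero_le_one⟩
  rwa [dist_self, mul_zero, hσ.map_zero, dist_eq_zero] at h

/-- Limits of rays are convex along the geodesics of a conical bicombing. -/
theorem IsLimitOfRay.diff_combing_le {σ : X → X → ℝ → X} (hσ : IsGeodesicBicombing σ)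
    (hcon : IsConical σ) {c : ℝ → X} {ξ : FunModConst X} (hξ : IsLimitOfRay ξ c) (x y : X)
    {s : ℝ} (hs : s ∈ Icc (0 : ℝ) 1) : ξ.diff (σ x y s) x ≤ s * ξ.diff y x := by
  refine le_of_tendsto_of_tendsto' (hξ _ _) ((hξ y x).const_mul s) fun t => ?_
  have h := hcon x (c t) y (c t) s hs
  rw [hσ.apply_self _ hs] at h
  linarith

variable {σ : X → X → ℝ → X} {x₀ : X}

theorem exists_combingBusemannPoint_diff_eq_of_base (hcomp : IsGeodesicallyComplete σ) {z : X}
    (hz : x₀ ≠ z) : ∃ ξ ∈ combingBusemannPoints σ x₀, ξ.diff x₀ z = dist x₀ z := by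
  obtain ⟨c, hc, rfl, hcz⟩ := hcomp x₀ z hz
  obtain ⟨ξ, hξ, hlim⟩ := hc.isGeodesicRay.exists_isLimitOfRay
  refine ⟨ξ, ⟨hξ, c, hc, rfl, hlim⟩, ?_⟩
  have h := hlim.diff_apply hc.isGeodesicRay (s := dist (c 0) z) dist_nonneg
  rwa [hcz] at h

/-- If finitely many Busemann points correspond to the `σ`-rays from `x₀`, then they compute all
distances. -/
theorem exists_combingBusemannPoint_diff_eq (hσ : IsGeodesicBicombing σ) (hcon : IsConical σ)
    (hcomp : IsGeodesicallyComplete σ) (hfin : (combingBusemannPoints σ x₀).Finite) {x y : X}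
    (hxy : x ≠ y) : ∃ ξ ∈ combingBusemannPoints σ x₀, ξ.diff x y = dist x y := by
  obtain ⟨c, hc, rfl, hcy⟩ := hcomp x y hxy
  have hdist : ∀ t : ℝ, 0 ≤ t → dist (c 0) (c t) = t := fun t ht => by
    rw [hc.isGeodesicRay 0 t le_rfl ht, zero_sub, abs_neg, abs_of_nonneg ht]
  -- Pigeonhole over the finite set: otherwise every `ξ` fails for all large `t`.
  have hfreq : ∃ ξ ∈ combingBusemannPoints σ x₀,
      ∃ᶠ t : ℝ in atTop, ξ.diff x₀ (c t) = dist x₀ (c t) := by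
    by_contra! hcontra
    have h1 : ∀ᶠ t : ℝ in atTop, ∀ ξ ∈ combingBusemannPoints σ x₀,
        ¬ ξ.diff x₀ (c t) = dist x₀ (c t) :=
      (eventually_all_finite hfin).2 fun ξ hξ => hcontra ξ hξ
    obtain ⟨t, h2, h3⟩ := (h1.and (eventually_gt_atTop (dist (c 0) x₀))).exists
    have hne : x₀ ≠ c t := by
      intro h
      rw [h, hdist t (dist_nonneg.trans h3.le)] at h3
      exact lt_irrefl _ h3
    obtain ⟨ξ, hξ, h4⟩ := exists_combingBusemannPoint_diff_eq_of_base hcomp hne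
    exact h2 ξ hξ h4
  obtain ⟨ξ, hξ, hfreq⟩ := hfreq
  obtain ⟨-, c', -, -, hlim⟩ := id hξ
  refine ⟨ξ, hξ, le_antisymm ((le_abs_self _).trans (hlim.abs_diff_le _ _)) ?_⟩
  set r := dist (c 0) y
  set D := dist (c 0) x₀
  -- Moving the base point from `x₀` to `c 0` costs `D` in `ξ` and `D` in the distance, so `ξ` drops
  -- by at least `t - 2D` on `[0, t]`; convexity at parameter `r / t` scales this.
  have hbound : ∃ᶠ t : ℝ in atTop, r - r * (2 * D) / t ≤ ξ.diff (c 0) y := by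
    refine (hfreq.and_eventually ((eventually_ge_atTop r).and (eventually_gt_atTop 0))).mono ?_
    rintro t ⟨h1, hrt, ht⟩
    have hs : r / t ∈ Icc (0 : ℝ) 1 :=
      ⟨div_nonneg dist_nonneg ht.le, (div_le_one ht).2 hrt⟩
    have h2 := hlim.diff_combing_le hσ hcon (c 0) (c t) hs
    rw [hc.combing_eq t ht.le _ hs, div_mul_cancel₀ _ ht.ne', hcy] at h2
    have h3 := ξ.diff_add_diff x₀ (c t) (c 0)
    have h4 := (le_abs_self _).trans (hlim.abs_diff_le x₀ (c 0))
    have h5 := dist_triangle (c 0) x₀ (c t)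
    rw [hdist t ht.le] at h5
    rw [dist_comm] at h4
    have h6 : ξ.diff (c t) (c 0) ≤ 2 * D - t := by linarith
    have h7 := mul_le_mul_of_nonneg_left h6 hs.1
    have h8 : r / t * (2 * D - t) = r * (2 * D) / t - r := by field_simp
    have h9 := ξ.diff_add_diff (c 0) y (c 0)
    have h10 := ξ.diff_add_diff (c 0) (c 0) (c 0)
    linarith
  have htend : Tendsto (fun t : ℝ => r - r * (2 * D) / t) atTop (𝓝 (r - 0)) :=
    tendsto_const_nhds.sub (tendsto_const_nhds.div_atTop tendsto_id)
  rw [sub_zero] at htend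
  exact le_of_tendsto_of_frequently htend hbound

/-- The differences of the Busemann points of the `σ`-rays from `x₀` embed `X` isometrically. -/
theorem isometry_combingBusemannPoints (hσ : IsGeodesicBicombing σ) (hcon : IsConical σ)
    (hcomp : IsGeodesicallyComplete σ) [Fintype (combingBusemannPoints σ x₀)] :
    Isometry fun (x : X) (ξ : combingBusemannPoints σ x₀) => ξ.1.diff x x₀ := by
  have hsub : ∀ (ξ : FunModConst X) (x y : X), ξ.diff x x₀ - ξ.diff y x₀ = ξ.diff x y :=
    fun ξ x y => by linarith [ξ.diff_add_diff x y x₀]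
  refine Isometry.of_dist_eq fun x y => le_antisymm ?_ ?_
  · refine (dist_pi_le_iff dist_nonneg).2 fun ξ => ?_
    obtain ⟨-, c, -, -, hlim⟩ := ξ.2
    rw [Real.dist_eq, hsub]
    exact hlim.abs_diff_le x y
  · rcases eq_or_ne x y with rfl | hxy
    · simp
    · obtain ⟨ξ, hξ, h⟩ := exists_combingBusemannPoint_diff_eq hσ hcon hcomp
        (toFinite (combingBusemannPoints σ x₀)) hxy
      refine le_trans ?_ (dist_le_pi_dist _ _ (⟨ξ, hξ⟩ : combingBusemannPoints σ x₀))
      rw [Real.dist_eq, hsub, h]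
      exact le_abs_self _

end Rays

end CombDim

theorem theorem6p7 {X : Type*} [MetricSpace X] [ProperSpace X]
    (σ : X → X → ℝ → X) (hσ : IsGeodesicBicombing σ) (hcon : IsConical σ)
    (hcomp : IsGeodesicallyComplete σ) (x₀ : X) (N : ℕ)
    (hN : (combingBusemannPoints σ x₀).encard ≤ N) :
    combinatorialDim X ≤ N := by
  have hfin : (combingBusemannPoints σ x₀).Finite := finite_of_encard_le_coe hN
  have : Fintype (combingBusemannPoints σ x₀) := hfin.fintype
  have : Nonempty X := ⟨x₀⟩
  refine (combinatorialDim_le_card (isometry_combingBusemannPoints (x₀ := x₀) hσ hcon hcomp)).trans ?_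
  have hcard : Fintype.card (combingBusemannPoints σ x₀) ≤ N := by
    rw [← Nat.card_eq_fintype_card, Nat.card_coe_set_eq]
    exact_mod_cast hfin.cast_ncard_eq.le.trans hN
  exact_mod_cast hcard
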